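/- Let $\Omega\subset\mathbb{R}^n$ be a bounded convex $G_\delta$-set with non-empty interior, and let $\rho$ be a metric on $\Omega$ such that (i) the topology induced by $\rho$ is the Euclidean one; (ii) every line segment in $\Omega$ is a geodesic of $(\Omega,\rho)$, i.e. $\rho(x,z)+\rho(z,y)=\rho(x,y)$ whenever $z$ lies on the segment $[x,y]$; (iii) the Lebesgue measure $\mathcal{L}^n$ on $(\Omega,\rho)$ is locally doubling, i.e. for every $R>0$ there is $C_R\ge 1$ with $\mathcal{L}^n(B_\rho(x,2r))\le C_R\,\mathcal{L}^n(B_\rho(x,r))$ for all $x\in\Omega$ and $0<r\le R$, where $B_\rho(x,r)=\{z\in\Omega : \rho(x,z)<r\}$. Let $\mu_1,\mu_2$ be Borel probability measures on $\Omega$ with compact support. Let $C\ge 1$ be a doubling constant of $\operatorname{supp}\mu_2$, i.e. for some $R>0$, $\mathcal{L}^n(B_\rho(x,2r))\le C\,\mathcal{L}^n(B_\rho(x,r))$ for all $x\in\operatorname{supp}\mu_2$ and $0<r\le R$ (any of the constants $C_R$ in (iii) is one), and put $d=\log_2 C$. For $\varepsilon>0$ and a Borel probability measure $\pi$ on $\Omega^2$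 let $$C_\varepsilon(\pi)=\frac1\varepsilon W_1\big((\mathrm{pr}_2)_\sharp\pi,\mu_2\big)+\int_{\Omega^2}\big(\rho(x,y)+\varepsilon|x-y|^2\big)\,d\pi(x,y)+\varepsilon^{3d+2}\,\#\operatorname{supp}\big((\mathrm{pr}_2)_\sharp\pi\big)\in[0,+\infty],$$ where $W_1$ is the $L^1$-Wasserstein distance with respect to $\rho$, and let $D_\varepsilon$ be the set of minimizers of $C_\varepsilon$ among all Borel probability measures on $\Omega^2$ with first marginal $\mu_1$. For every $\varepsilon>0$ let $\pi_\varepsilon\in D_\varepsilon$. Then the second marginal $(\mathrm{pr}_2)_\sharp\pi_\varepsilon$ converges weakly to $\mu_2$ as $\varepsilon\to0$. Moreover, every limit point $\pi_*$ (for weak convergence, as $\varepsilon\to0$) of $\{\pi_\varepsilon\}_{\varepsilon>0}$ is a transport plan from $\mu_1$ to $\mu_2$ that minimizes $\int_{\Omega^2}\rho\,d\pi$ among all transport plans $\pi$ from $\mu_1$ to $\mu_2$, and it minimizes $\int_{\Omega^2}|x-y|^2\,d\pi$ among all such $\rho$-optimal transport plans. -/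

import Mathlib

open MeasureTheory Filter Topology
open scoped ENNReal

namespace MongeProjective

section Transport

variable {X : Type*} [MeasurableSpace X]

/-- The first marginal of a Borel probability measure on the product `X × X`. -/
noncomputable def marginalOne (π : ProbabilityMeasure (X × X)) : ProbabilityMeasure X :=
  π.map measurable_fst.aemeasurable

/-- The second marginal of a Borel probability measure on the product `X × X`. -/
noncomputable def marginalTwo (π : ProbabilityMeasure (X × X)) : ProbabilityMeasure X :=
  π.map measurable_snd.aemeasurable

/-- The set of transport plans from `μ₁` to `μ₂`. -/
def plans (μ₁ μ₂ : ProbabilityMeasure X) : Set (ProbabilityMeasure (X × X)) :=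
  {π | marginalOne π = μ₁ ∧ marginalTwo π = μ₂}

/-- The total cost of the plan `π` for the cost function `c`, as an element of `[0, ∞]`. -/
noncomputable def totalCost (c : X → X → ℝ≥0∞) (π : ProbabilityMeasure (X × X)) : ℝ≥0∞ :=
  ∫⁻ p, c p.1 p.2 ∂(π : Measure (X × X))

/-- The minimizers of a functional `F` over the feasible set `S`. -/
def minimizers {α : Type*} (F : α → ℝ≥0∞) (S : Set α) : Set α :=
  {a | a ∈ S ∧ ∀ b ∈ S, F a ≤ F b}

end Transport

section Metric

variable {n : ℕ} {Ω : Set (EuclideanSpace ℝ (Fin n))}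

/-- The open ball of the metric `ρ` on `Ω`, as a subset of the ambient Euclidean space. -/
def rhoBall (ρ : MetricSpace Ω) (x : Ω) (r : ℝ) : Set (EuclideanSpace ℝ (Fin n)) :=
  Subtype.val '' {z : Ω | ρ.dist x z < r}

/-- Assumption A on a metric `ρ` on `Ω`. -/
structure AssumptionA (ρ : MetricSpace Ω) : Prop where
  /-- The topology induced by `ρ` is the Euclidean (subspace) topology of `Ω`. -/
  topology_eq : ρ.toPseudoMetricSpace.toUniformSpace.toTopologicalSpace =
    (instTopologicalSpaceSubtype : TopologicalSpace Ω)
  /-- Line segments are geodesics: `ρ` is additive along every segment contained in `Ω`. -/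
  segment_geodesic : ∀ x y z : Ω,
    (z : EuclideanSpace ℝ (Fin n)) ∈ segment ℝ (x : EuclideanSpace ℝ (Fin n)) y →
      ρ.dist x z + ρ.dist z y = ρ.dist x y
  /-- The Lebesgue measure on `(Ω, ρ)` is locally doubling. -/
  locally_doubling : ∀ R : ℝ, 0 < R → ∃ C : ℝ, 1 ≤ C ∧ ∀ (x : Ω) (r : ℝ), 0 < r → r ≤ R →
    volume (rhoBall ρ x (2 * r)) ≤ ENNReal.ofReal C * volume (rhoBall ρ x r)

/-- `C` is a doubling constant of the set `K ⊆ Ω` : the doubling inequality for the Lebesgue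
measure holds with the constant `C` for all `ρ`-balls centred in `K` of radius at most some
`R > 0`. In particular every constant `C_R` of the locally doubling condition, for whatever
`R > 0`, is a doubling constant of every `K`. -/
def IsDoublingConstant (ρ : MetricSpace Ω) (K : Set Ω) (C : ℝ) : Prop :=
  1 ≤ C ∧ ∃ R : ℝ, 0 < R ∧ ∀ x ∈ K, ∀ r : ℝ, 0 < r → r ≤ R →
    volume (rhoBall ρ x (2 * r)) ≤ ENNReal.ofReal C * volume (rhoBall ρ x r)

/-- The cost function `ρ`. -/
noncomputable def rhoCost (ρ : MetricSpace Ω) (x y : Ω) : ℝ≥0∞ :=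
  ENNReal.ofReal (ρ.dist x y)

/-- The squared Euclidean distance as a cost function. -/
noncomputable def sqCost (x y : Ω) : ℝ≥0∞ :=
  ENNReal.ofReal (‖(x : EuclideanSpace ℝ (Fin n)) - y‖ ^ 2)

/-- The cost function `c_ε(x, y) = ρ(x, y) + ε |x - y|²`. -/
noncomputable def perturbedCost (ρ : MetricSpace Ω) (ε : ℝ) (x y : Ω) : ℝ≥0∞ :=
  ENNReal.ofReal (ρ.dist x y + ε * ‖(x : EuclideanSpace ℝ (Fin n)) - y‖ ^ 2)

/-- The `L¹`-Wasserstein distance with respect to `ρ`, as an element of `[0, ∞]`. -/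
noncomputable def wassersteinOne (ρ : MetricSpace Ω) (μ ν : ProbabilityMeasure Ω) : ℝ≥0∞ :=
  ⨅ π ∈ plans μ ν, totalCost (rhoCost ρ) π

/-- The functional `C_ε(π) = ε⁻¹ W₁((pr₂)♯π, μ₂) + ∫ c_ε dπ + ε ^ (3d + 2) · #supp((pr₂)♯π)`,
with values in `[0, ∞]`; the cardinality is `∞` for an infinite support. -/
noncomputable def penalized (ρ : MetricSpace Ω) (μ₂ : ProbabilityMeasure Ω) (d ε : ℝ)
    (π : ProbabilityMeasure (Ω × Ω)) : ℝ≥0∞ :=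
  ENNReal.ofReal (1 / ε) * wassersteinOne ρ (marginalTwo π) μ₂
    + totalCost (perturbedCost ρ ε) π
    + ENNReal.ofReal (ε ^ (3 * d + 2)) *
      ((marginalTwo π : Measure Ω).support.encard : ℝ≥0∞)

/-- The set `D_ε` of minimizers of `C_ε` among the measures with first marginal `μ₁`. -/
def penalizedMinimizers (ρ : MetricSpace Ω) (μ₁ μ₂ : ProbabilityMeasure Ω) (d ε : ℝ) :
    Set (ProbabilityMeasure (Ω × Ω)) :=
  minimizers (penalized ρ μ₂ d ε) {π | marginalOne π = μ₁}

/-- The set `𝒪₀(μ₁, μ₂)` of `ρ`-optimal transport plans. -/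
def optimalPlans (ρ : MetricSpace Ω) (μ₁ μ₂ : ProbabilityMeasure Ω) :
    Set (ProbabilityMeasure (Ω × Ω)) :=
  minimizers (totalCost (rhoCost ρ)) (plans μ₁ μ₂)

/-- The set `𝒪₁(μ₁, μ₂)` of the `ρ`-optimal transport plans that minimize `∫ |x - y|² dπ` among all
`ρ`-optimal transport plans. -/
def secondaryOptimalPlans (ρ : MetricSpace Ω) (μ₁ μ₂ : ProbabilityMeasure Ω) :
    Set (ProbabilityMeasure (Ω × Ω)) :=
  minimizers (totalCost sqCost) (optimalPlans ρ μ₁ μ₂)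

end Metric

end MongeProjective

/-!
The second marginals and the limit points of the minimizers `π_ε` are controlled by one upper bound on
the minimal value of `C_ε`. Push the second coordinate of any plan `σ` from `μ₁` to `μ₂` to the nearest
point of a `δ`-net of `supp μ₂`. This changes `W₁` and `∫ ρ` by at most `δ` and the secondary cost
`∫ |x - y|²` by `o(1)`, and the new second marginal is supported on the net. A volume-packing argument
shows that the net can be chosen with `O(δ ^ (-d))` points (`exists_net_of_doubling`); convexity enters
only here, to see that balls of `ρ` have positive Lebesgue measure. With `δ = ε ^ 3` the penalties
`δ / ε`, `δ` and `ε ^ (3 d + 2) δ ^ (-d)` are all `O(ε ^ 2)`, so that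
`C_ε(π_ε) ≤ ∫ ρ dσ + ε ∫ |x - y|² dσ + o(ε)` (`eventually_penalizedCost_le`).

The term `ε⁻¹ W₁` then forces `W₁((pr₂)♯π_ε, μ₂) = O(ε)`, which gives weak convergence of the second
marginals. Lower semicontinuity of `π ↦ ∫ ρ dπ` shows that limit points are `ρ`-optimal. If `σ` is
itself `ρ`-optimal, the triangle inequality for `W₁` gives
`∫ ρ dσ = W₁(μ₁, μ₂) ≤ ∫ ρ dπ_ε + W₁((pr₂)♯π_ε, μ₂)`, and for `ε ≤ 1` the last term is absorbed by the
penalty. Cancelling `∫ ρ dσ` and dividing by `ε` leaves `∫ |x - y|² dπ_ε ≤ ∫ |x - y|² dσ + o(1)`, which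
passes to limit points by lower semicontinuity again.

The argument is carried out on a metric space `X` with its own topology, for `edist` as the primary cost
and a continuous function `q` as the secondary one (`tendsto_and_mapClusterPt_of_minimizers`), and then
applied to `Ω` with the metric `ρ`.
-/

namespace MongeProjective


/-! ### Transport plans, gluing -/

section Plans

variable {X : Type*} [MeasurableSpace X]

open scoped NNReal

theorem coe_marginalOne (π : ProbabilityMeasure (X × X)) :
    (marginalOne π : Measure X) = (π : Measure (X × X)).map Prod.fst := rfl

theorem coe_marginalTwo (π : ProbabilityMeasure (X × X)) :
    (marginalTwo π : Measure X) = (π : Measure (X × X)).map Prod.snd := rfl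

theorem mem_plans_iff {μ ν : ProbabilityMeasure X} {π : ProbabilityMeasure (X × X)} :
    π ∈ plans μ ν ↔ (π : Measure (X × X)).map Prod.fst = (μ : Measure X) ∧
      (π : Measure (X × X)).map Prod.snd = (ν : Measure X) := by
  simp only [plans, Set.mem_ofPred_eq, ← coe_marginalOne, ← coe_marginalTwo]
  exact and_congr (Subtype.ext_iff) (Subtype.ext_iff)

/-- The optimal transport cost between `μ` and `ν` for the cost function `c`. -/
noncomputable def transportCost (c : X → X → ℝ≥0∞) (μ ν : ProbabilityMeasure X) : ℝ≥0∞ :=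
  ⨅ π ∈ plans μ ν, totalCost c π

theorem transportCost_le {c : X → X → ℝ≥0∞} {μ ν : ProbabilityMeasure X}
    {π : ProbabilityMeasure (X × X)} (hπ : π ∈ plans μ ν) :
    transportCost c μ ν ≤ totalCost c π :=
  iInf₂_le π hπ

/-- The image of a probability measure under a pair of measurable maps, as a transport plan between
the images under each of them. -/
theorem map_prodMk_mem_plans {Y : Type*} [MeasurableSpace Y] (μ : ProbabilityMeasure Y)
    {f g : Y → X} (hf : Measurable f) (hg : Measurable g) :
    μ.map (hf.prodMk hg).aemeasurable ∈ plans (μ.map hf.aemeasurable) (μ.map hg.aemeasurable) := by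
  rw [mem_plans_iff]
  simp only [ProbabilityMeasure.toMeasure_map]
  rw [Measure.map_map measurable_fst (hf.prodMk hg), Measure.map_map measurable_snd (hf.prodMk hg)]
  exact ⟨rfl, rfl⟩

theorem totalCost_map_prodMk {Y : Type*} [MeasurableSpace Y] (μ : ProbabilityMeasure Y)
    {f g : Y → X} (hf : Measurable f) (hg : Measurable g) {c : X → X → ℝ≥0∞}
    (hc : Measurable (Function.uncurry c)) :
    totalCost c (μ.map (hf.prodMk hg).aemeasurable) = ∫⁻ y, c (f y) (g y) ∂(μ : Measure Y) := by
  simp only [totalCost, ProbabilityMeasure.toMeasure_map]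
  exact lintegral_map (f := fun p : X × X => c p.1 p.2) hc (hf.prodMk hg)

/-- The gluing lemma: two plans sharing a middle marginal are the projections of a measure on the
triple product. -/
theorem exists_gluing [StandardBorelSpace X] {μ ν ξ : ProbabilityMeasure X}
    {π₁ π₂ : ProbabilityMeasure (X × X)} (h₁ : π₁ ∈ plans μ ν) (h₂ : π₂ ∈ plans ν ξ) :
    ∃ γ : ProbabilityMeasure ((X × X) × X),
      (γ : Measure ((X × X) × X)).map Prod.fst = (π₁ : Measure (X × X)) ∧
      (γ : Measure ((X × X) × X)).map (fun p => (p.1.2, p.2)) = (π₂ : Measure (X × X)) := by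
  rw [mem_plans_iff] at h₁ h₂
  have : Nonempty X := ν.nonempty
  let κ := (π₂ : Measure (X × X)).condKernel
  have hdis : (ν : Measure X).compProd κ = (π₂ : Measure (X × X)) := by
    rw [← h₂.1]
    exact (π₂ : Measure (X × X)).disintegrate κ
  have hm : Measurable (fun p : (X × X) × X => (p.1.2, p.2)) := by fun_prop
  refine ⟨⟨(π₁ : Measure (X × X)).compProd (κ.comap Prod.snd measurable_snd), inferInstance⟩,
    Measure.fst_compProd _ _, ?_⟩
  refine Measure.ext_of_lintegral _ fun f hf => ?_
  rw [ProbabilityMeasure.coe_mk, lintegral_map hf hm,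
    Measure.lintegral_compProd (f := fun p : (X × X) × X => f (p.1.2, p.2)) (hf.comp hm), ← hdis,
    Measure.lintegral_compProd hf, ← h₁.2,
    lintegral_map (hf.lintegral_kernel_prod_right' (κ := κ)) measurable_snd]
  rfl

end Plans

/-! ### The Wasserstein distance and weak convergence -/

section Metric

variable {X : Type*} [MeasurableSpace X]

open scoped NNReal

/-- The triangle inequality for the `L¹`-Wasserstein distance. -/
theorem transportCost_edist_triangle [PseudoEMetricSpace X] [SecondCountableTopology X]
    [OpensMeasurableSpace X] [StandardBorelSpace X] (μ ν ξ : ProbabilityMeasure X) :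
    transportCost edist μ ξ ≤ transportCost edist μ ν + transportCost edist ν ξ := by
  simp only [transportCost, ENNReal.iInf_add, ENNReal.add_iInf]
  refine le_iInf₂ fun π₂ h₂ => le_iInf₂ fun π₁ h₁ => ?_
  obtain ⟨γ, hγ₁, hγ₂⟩ := exists_gluing h₁ h₂
  rw [mem_plans_iff] at h₁ h₂
  have hm : Measurable (fun p : (X × X) × X => (p.1.2, p.2)) := by fun_prop
  have hf : Measurable (fun p : (X × X) × X => p.1.1) := by fun_prop
  have hμ : γ.map hf.aemeasurable = μ := by
    refine Subtype.ext ?_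
    change (γ : Measure ((X × X) × X)).map (Prod.fst ∘ Prod.fst) = μ
    rw [← Measure.map_map measurable_fst measurable_fst, hγ₁, h₁.1]
  have hξ : γ.map measurable_snd.aemeasurable = ξ := by
    refine Subtype.ext ?_
    change (γ : Measure ((X × X) × X)).map (Prod.snd ∘ (fun p : (X × X) × X => (p.1.2, p.2))) = ξ
    rw [← Measure.map_map measurable_snd hm, hγ₂, h₂.2]
  have hplan := map_prodMk_mem_plans γ hf measurable_snd
  rw [hμ, hξ] at hplan
  have hed : Measurable (fun p : X × X => edist p.1 p.2) := measurable_edist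
  refine (iInf₂_le _ hplan).trans ?_
  rw [totalCost_map_prodMk γ hf measurable_snd hed]
  simp only [totalCost]
  rw [← hγ₁, ← hγ₂, lintegral_map hed measurable_fst, lintegral_map hed hm,
    ← lintegral_add_left (f := fun p : (X × X) × X => edist p.1.1 p.1.2)
      (hed.comp measurable_fst)]
  exact lintegral_mono fun p => edist_triangle _ _ _

/-- The easy half of Kantorovich duality. -/
theorem enorm_integral_sub_le_mul_transportCost [PseudoEMetricSpace X] [OpensMeasurableSpace X]
    {μ ν : ProbabilityMeasure X} {f : X → ℝ} {L : ℝ≥0} (hf : LipschitzWith L f) (hL : L ≠ 0)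
    (hμ : Integrable f (μ : Measure X)) (hν : Integrable f (ν : Measure X)) :
    ‖∫ x, f x ∂(μ : Measure X) - ∫ x, f x ∂(ν : Measure X)‖ₑ ≤ L * transportCost edist μ ν := by
  have hL' : (L : ℝ≥0∞) ≠ 0 := by simpa using hL
  rw [mul_comm, ← ENNReal.div_le_iff hL' ENNReal.coe_ne_top]
  refine le_iInf₂ fun π hπ => ?_
  rw [ENNReal.div_le_iff hL' ENNReal.coe_ne_top]
  rw [mem_plans_iff] at hπ
  have hfm := hf.continuous.measurable
  rw [← hπ.1] at hμ ⊢
  rw [← hπ.2] at hν ⊢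
  rw [integral_map measurable_fst.aemeasurable hfm.aestronglyMeasurable,
    integral_map measurable_snd.aemeasurable hfm.aestronglyMeasurable,
    ← integral_sub (f := fun p : X × X => f p.1) (g := fun p : X × X => f p.2)
      (hμ.comp_measurable measurable_fst) (hν.comp_measurable measurable_snd)]
  refine (enorm_integral_le_lintegral_enorm _).trans ?_
  rw [totalCost, mul_comm, ← lintegral_const_mul' _ _ ENNReal.coe_ne_top]
  refine lintegral_mono fun p => ?_
  simp only [← edist_eq_enorm_sub]
  exact hf p.1 p.2

theorem tendsto_of_tendsto_transportCost [PseudoEMetricSpace X] [OpensMeasurableSpace X]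
    {ι : Type*} {l : Filter ι} [l.IsCountablyGenerated] {ν : ι → ProbabilityMeasure X}
    {μ : ProbabilityMeasure X} (h : Tendsto (fun i => transportCost edist (ν i) μ) l (𝓝 0)) :
    Tendsto ν l (𝓝 μ) := by
  rw [tendsto_iff_forall_lipschitz_integral_tendsto]
  rintro f ⟨B, hB⟩ ⟨L, hL⟩
  have hint (ξ : ProbabilityMeasure X) : Integrable f (ξ : Measure X) := by
    obtain ⟨x₀⟩ := ξ.nonempty
    refine Integrable.of_bound (C := ‖f x₀‖ + B) hL.continuous.measurable.aestronglyMeasurable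
      (Eventually.of_forall fun x => ?_)
    have := hB x x₀
    rw [dist_eq_norm] at this
    linarith [norm_le_norm_add_norm_sub' (f x) (f x₀), norm_sub_rev (f x) (f x₀)]
  rw [tendsto_iff_edist_tendsto_0]
  have hlim : Tendsto (fun i => ((L + 1 : ℝ≥0) : ℝ≥0∞) * transportCost edist (ν i) μ) l (𝓝 0) := by
    simpa using ENNReal.Tendsto.const_mul (a := ((L + 1 : ℝ≥0) : ℝ≥0∞)) h
      (Or.inr ENNReal.coe_ne_top)
  refine tendsto_of_tendsto_of_tendsto_of_le_of_le tendsto_const_nhds hlim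
    (fun _ => bot_le) fun i => ?_
  simp only [edist_eq_enorm_sub]
  exact enorm_integral_sub_le_mul_transportCost (hL.weaken (by simp)) (by simp) (hint _) (hint _)

/-- The total cost of a continuous cost function is lower semicontinuous for weak convergence. -/
theorem lowerSemicontinuous_totalCost [TopologicalSpace X] [OpensMeasurableSpace (X × X)]
    {c : X → X → ℝ≥0∞} (hc : Continuous (Function.uncurry c)) :
    LowerSemicontinuous (totalCost c) := by
  -- The cost is the supremum of its truncations at height `n`, whose integrals depend continuously
  -- on `π`.
  let g (n : ℕ) (p : X × X) : ℝ≥0 := (min (c p.1 p.2) n).toNNReal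
  have hg_coe (n : ℕ) (p : X × X) : (g n p : ℝ≥0∞) = min (c p.1 p.2) n :=
    ENNReal.coe_toNNReal (min_lt_of_right_lt (ENNReal.natCast_lt_top n)).ne
  have hg_le (n : ℕ) (p : X × X) : g n p ≤ n := by
    rw [← ENNReal.coe_le_coe, hg_coe]; exact min_le_right _ _
  have hg_cont (n : ℕ) : Continuous (g n) := by
    rw [← ENNReal.continuous_coe_iff]
    simp only [hg_coe]
    exact hc.min continuous_const
  let G (n : ℕ) : BoundedContinuousFunction (X × X) ℝ≥0 :=
    BoundedContinuousFunction.mkOfBound ⟨g n, hg_cont n⟩ n fun p q => by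
      rw [NNReal.dist_eq, abs_le]
      have h1 : (g n p : ℝ) ≤ n := mod_cast hg_le n p
      have h2 : (g n q : ℝ) ≤ n := mod_cast hg_le n q
      constructor <;> simp only [ContinuousMap.coe_mk] <;>
        linarith [(g n p).coe_nonneg, (g n q).coe_nonneg]
  have hsup (π : ProbabilityMeasure (X × X)) :
      totalCost c π = ⨆ n, ∫⁻ p, G n p ∂(π : Measure (X × X)) := by
    rw [← lintegral_iSup]
    · refine lintegral_congr fun p => ?_
      change c p.1 p.2 = ⨆ n, (g n p : ℝ≥0∞)
      simp only [hg_coe]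
      refine le_antisymm ?_ (iSup_le fun n => min_le_left _ _)
      refine le_of_forall_lt fun t ht => ?_
      obtain ⟨n, hn⟩ := ENNReal.exists_nat_gt ht.ne_top
      exact lt_of_lt_of_le (lt_min ht hn) (le_iSup (fun n : ℕ => min (c p.1 p.2) (n : ℝ≥0∞)) n)
    · exact fun n => (ENNReal.continuous_coe.comp (hg_cont n)).measurable
    · intro m n hmn p
      change (g m p : ℝ≥0∞) ≤ g n p
      rw [hg_coe, hg_coe]
      gcongr
  have hfun : totalCost c = fun π : ProbabilityMeasure (X × X) =>
      ⨆ n, ∫⁻ p, G n p ∂(π : Measure (X × X)) := funext hsup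
  rw [hfun]
  refine lowerSemicontinuous_iSup fun n => Continuous.lowerSemicontinuous ?_
  refine continuous_iff_continuousAt.2 fun π => ?_
  exact (ProbabilityMeasure.tendsto_iff_forall_lintegral_tendsto.1 tendsto_id) (G n)

/-- A lower semicontinuous function is bounded at a cluster point of a family by any limit of
eventual upper bounds along the family. -/
theorem le_of_mapClusterPt_of_lowerSemicontinuous {α β ι : Type*} [TopologicalSpace α] [LinearOrder β]
    [TopologicalSpace β] [OrderTopology β] [DenselyOrdered β]
    {F : α → β} (hF : LowerSemicontinuous F) {l : Filter ι} {u : ι → α} {a : α}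
    (ha : MapClusterPt a l u) {B : ι → β} {b : β} (hB : Tendsto B l (𝓝 b))
    (h : ∀ᶠ i in l, F (u i) ≤ B i) : F a ≤ b := by
  by_contra! hlt
  obtain ⟨t, hbt, hta⟩ := exists_between hlt
  have hfreq := mapClusterPt_iff_frequently.1 ha _ (hF a t hta)
  obtain ⟨i, h1, h2, h3⟩ := (hfreq.and_eventually (h.and (hB.eventually_lt_const hbt))).exists
  exact absurd h1 (h2.trans_lt h3).asymm

theorem eq_of_mapClusterPt_of_tendsto {α β ι : Type*} [TopologicalSpace α] [TopologicalSpace β]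
    [T2Space β] {l : Filter ι} {u : ι → α} {a : α} (ha : MapClusterPt a l u) {f : α → β}
    (hf : ContinuousAt f a) {b : β} (hb : Tendsto (fun i => f (u i)) l (𝓝 b)) : f a = b := by
  have h : ClusterPt (f a) (𝓝 b) :=
    ClusterPt.mono (mapClusterPt_def.1 (ha.continuousAt_comp hf)) hb
  exact eq_of_nhds_neBot h

end Metric


/-! ### Discretization of the target -/

section Discretization

variable {X : Type*} [MeasurableSpace X]

open scoped NNReal

/-- A measurable nearest-point map onto a finite set. -/
theorem exists_measurable_nearest [PseudoEMetricSpace X] [OpensMeasurableSpace X] {t : Finset X}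
    (ht : t.Nonempty) :
    ∃ T : X → X, Measurable T ∧ (∀ y, T y ∈ t) ∧ ∀ y, ∀ z ∈ t, edist (T y) y ≤ edist z y := by
  obtain ⟨e, he⟩ := t.countable_toSet.exists_eq_range ht
  have hidx : ∀ z : X, ∃ k, z ∈ t → e k = z := fun z => by
    by_cases hz : z ∈ t
    · have hz' : z ∈ Set.range e := he ▸ (Finset.mem_coe.2 hz)
      obtain ⟨k, hk⟩ := hz'
      exact ⟨k, fun _ => hk⟩
    · exact ⟨0, fun h => absurd h hz⟩
  choose idx hidx using hidx
  refine ⟨SimpleFunc.nearestPt e (t.sup idx), SimpleFunc.measurable _, fun y => ?_,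
    fun y z hz => ?_⟩
  · rw [← Finset.mem_coe, he]
    exact ⟨SimpleFunc.nearestPtInd e (t.sup idx) y, rfl⟩
  · have h := SimpleFunc.edist_nearestPt_le e y (Finset.le_sup (f := idx) hz)
    rwa [hidx z hz] at h

theorem encard_support_map_le [TopologicalSpace X] [T1Space X] [OpensMeasurableSpace X]
    {Y : Type*} [MeasurableSpace Y] (μ : Measure Y) {T : Y → X} (hT : Measurable T)
    {t : Finset X} (ht : ∀ y, T y ∈ t) : (μ.map T).support.encard ≤ t.card := by
  have hsub : (μ.map T).support ⊆ (t : Set X) := by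
    refine Measure.support_subset_of_isClosed t.finite_toSet.isClosed ?_
    rw [mem_ae_map_iff hT.aemeasurable t.finite_toSet.measurableSet]
    exact Eventually.of_forall ht
  exact (Set.encard_le_encard hsub).trans (Set.encard_coe_eq_coe_finsetCard t).le

/-- The functional `C_ε` on a metric space, for a general secondary cost `q` in place of the squared
Euclidean distance. -/
noncomputable def penalizedCost [PseudoEMetricSpace X] (q : X → X → ℝ≥0∞)
    (μ₂ : ProbabilityMeasure X) (d ε : ℝ) (π : ProbabilityMeasure (X × X)) : ℝ≥0∞ :=
  ENNReal.ofReal (1 / ε) * transportCost edist (marginalTwo π) μ₂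
    + (totalCost edist π + ENNReal.ofReal ε * totalCost q π)
    + ENNReal.ofReal (ε ^ (3 * d + 2)) * ((marginalTwo π : Measure X).support.encard : ℝ≥0∞)

variable [EMetricSpace X] [SecondCountableTopology X] [BorelSpace X]
  {μ₁ μ₂ : ProbabilityMeasure X}

omit [BorelSpace X] in
theorem ae_mem_support_prod {π : ProbabilityMeasure (X × X)} (hπ : π ∈ plans μ₁ μ₂) :
    ∀ᵐ p ∂(π : Measure (X × X)),
      p.1 ∈ (μ₁ : Measure X).support ∧ p.2 ∈ (μ₂ : Measure X).support := by
  rw [mem_plans_iff] at hπ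
  have h₁ : ∀ᵐ x ∂(π : Measure (X × X)).map Prod.fst, x ∈ (μ₁ : Measure X).support := by
    rw [hπ.1]; exact Measure.support_mem_ae
  have h₂ : ∀ᵐ x ∂(π : Measure (X × X)).map Prod.snd, x ∈ (μ₂ : Measure X).support := by
    rw [hπ.2]; exact Measure.support_mem_ae
  exact (ae_of_ae_map measurable_fst.aemeasurable h₁).and
    (ae_of_ae_map measurable_snd.aemeasurable h₂)

omit [BorelSpace X] in
theorem totalCost_lt_top (hμ₁ : IsCompact (μ₁ : Measure X).support)
    (hμ₂ : IsCompact (μ₂ : Measure X).support) {c : X → X → ℝ≥0∞}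
    (hc : Continuous (Function.uncurry c)) (hfin : ∀ x y, c x y ≠ ∞)
    {π : ProbabilityMeasure (X × X)} (hπ : π ∈ plans μ₁ μ₂) : totalCost c π < ∞ := by
  have hne : ((μ₁ : Measure X).support ×ˢ (μ₂ : Measure X).support).Nonempty :=
    (Measure.nonempty_support (NeZero.ne _)).prod (Measure.nonempty_support (NeZero.ne _))
  obtain ⟨p₀, -, hp₀⟩ := (hμ₁.prod hμ₂).exists_isMaxOn hne hc.continuousOn
  calc totalCost c π ≤ ∫⁻ _, c p₀.1 p₀.2 ∂(π : Measure (X × X)) :=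
        lintegral_mono_ae ((ae_mem_support_prod hπ).mono fun p hp => hp₀ (Set.mk_mem_prod hp.1 hp.2))
    _ < ∞ := by simpa using (hfin _ _).lt_top

/-- Moving the second coordinate of a plan to the nearest point of a finite `δ`-net of the support of
the target yields a competitor for `penalizedCost`, at a cost controlled by `δ`, by the modulus `η`
of the secondary cost and by the size of the net. -/
theorem exists_penalizedCost_le_of_net {q : X → X → ℝ≥0∞}
    (hq : Measurable (Function.uncurry q)) (d : ℝ) {ε : ℝ} {δ η : ℝ≥0∞}
    {t : Finset X} (ht : (t : Set X) ⊆ (μ₂ : Measure X).support)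
    (hnet : ∀ y ∈ (μ₂ : Measure X).support, ∃ z ∈ t, edist z y ≤ δ)
    (hmod : ∀ x ∈ (μ₁ : Measure X).support, ∀ y ∈ (μ₂ : Measure X).support,
      ∀ z ∈ (μ₂ : Measure X).support, edist z y ≤ δ → q x z ≤ q x y + η)
    {π : ProbabilityMeasure (X × X)} (hπ : π ∈ plans μ₁ μ₂) :
    ∃ π' : ProbabilityMeasure (X × X), marginalOne π' = μ₁ ∧
      penalizedCost q μ₂ d ε π' ≤ ENNReal.ofReal (1 / ε) * δ
        + (totalCost edist π + δ + ENNReal.ofReal ε * (totalCost q π + η))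
        + ENNReal.ofReal (ε ^ (3 * d + 2)) * t.card := by
  have htne : t.Nonempty := by
    obtain ⟨y, hy⟩ := Measure.nonempty_support (NeZero.ne (μ₂ : Measure X))
    obtain ⟨z, hz, -⟩ := hnet y hy
    exact ⟨z, hz⟩
  obtain ⟨T, hTm, hTt, hTle⟩ := exists_measurable_nearest htne
  have hTδ : ∀ y ∈ (μ₂ : Measure X).support, edist (T y) y ≤ δ := fun y hy => by
    obtain ⟨z, hz, hzy⟩ := hnet y hy
    exact (hTle y z hz).trans hzy
  have hTs : Measurable (fun p : X × X => T p.2) := hTm.comp measurable_snd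
  have hed : Measurable (fun p : X × X => edist p.1 p.2) := measurable_edist
  have hmem := map_prodMk_mem_plans π measurable_fst hTs
  have hae := ae_mem_support_prod hπ
  have hnet' := map_prodMk_mem_plans π hTs measurable_snd
  have hπ₁ : π.map measurable_fst.aemeasurable = μ₁ := hπ.1
  have hπ₂ : π.map measurable_snd.aemeasurable = μ₂ := hπ.2
  rw [hπ₁] at hmem
  rw [hπ₂] at hnet'
  refine ⟨π.map (measurable_fst.prodMk hTs).aemeasurable, hmem.1, ?_⟩
  have hadd (f : X × X → ℝ≥0∞) (b : ℝ≥0∞) :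
      ∫⁻ p, (f p + b) ∂(π : Measure (X × X)) = ∫⁻ p, f p ∂(π : Measure (X × X)) + b := by
    rw [lintegral_add_right _ measurable_const]; simp
  rw [penalizedCost, hmem.2]
  gcongr
  · refine (transportCost_le hnet').trans ?_
    rw [totalCost_map_prodMk π hTs measurable_snd hed]
    calc ∫⁻ p, edist (T p.2) p.2 ∂(π : Measure (X × X)) ≤ ∫⁻ _, δ ∂(π : Measure (X × X)) :=
          lintegral_mono_ae (hae.mono fun p hp => hTδ _ hp.2)
      _ = δ := by simp
  · rw [totalCost_map_prodMk π measurable_fst hTs hed, totalCost, ← hadd]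
    refine lintegral_mono_ae (hae.mono fun p hp => ?_)
    calc edist p.1 (T p.2) ≤ edist p.1 p.2 + edist p.2 (T p.2) := edist_triangle _ _ _
      _ ≤ edist p.1 p.2 + δ := by
        gcongr
        rw [edist_comm]
        exact hTδ _ hp.2
  · rw [totalCost_map_prodMk π measurable_fst hTs hq, totalCost, ← hadd]
    exact lintegral_mono_ae (hae.mono fun p hp =>
      hmod _ hp.1 _ hp.2 _ (ht (hTt _)) (hTδ _ hp.2))
  · have := encard_support_map_le (π : Measure (X × X)) hTs (fun p => hTt p.2)
    exact_mod_cast this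

end Discretization

/-! ### Convergence of minimizers on a metric space -/

section Convergence

variable {X : Type*} [MeasurableSpace X]

open scoped NNReal

variable [MetricSpace X] [SecondCountableTopology X] [BorelSpace X]
  {μ₁ μ₂ : ProbabilityMeasure X}

/-- With nets of mesh `δ = ε ^ 3`, which have `O(ε ^ (-3 d))` points, every term of the cost of the
discretized competitor that is due to the discretization is `o(ε)`. -/
theorem eventually_penalizedCost_le {q : X → X → ℝ≥0} (hq : Continuous (Function.uncurry q))
    (hμ₁ : IsCompact (μ₁ : Measure X).support) (hμ₂ : IsCompact (μ₂ : Measure X).support)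
    {d M : ℝ} (hcov : ∀ᶠ δ in 𝓝[>] (0 : ℝ), ∃ t : Finset X, (t : Set X) ⊆ (μ₂ : Measure X).support ∧
      (t.card : ℝ) ≤ M * δ ^ (-d) ∧
      ∀ y ∈ (μ₂ : Measure X).support, ∃ z ∈ t, edist z y ≤ ENNReal.ofReal δ)
    {π : ℝ → ProbabilityMeasure (X × X)}
    (hπ : ∀ ε : ℝ, 0 < ε →
      π ε ∈ minimizers (penalizedCost (fun x y => (q x y : ℝ≥0∞)) μ₂ d ε) {π | marginalOne π = μ₁})
    {η : ℝ} (hη : 0 < η) :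
    ∀ᶠ ε in 𝓝[>] (0 : ℝ), ∀ σ ∈ plans μ₁ μ₂,
      penalizedCost (fun x y => (q x y : ℝ≥0∞)) μ₂ d ε (π ε) ≤ totalCost edist σ
        + ENNReal.ofReal ε * totalCost (fun x y => (q x y : ℝ≥0∞)) σ + ENNReal.ofReal (ε * η) := by
  have hpos : ∀ᶠ ε in 𝓝[>] (0 : ℝ), 0 < ε := eventually_mem_nhdsWithin
  have hcube : Tendsto (fun ε : ℝ => ε ^ 3) (𝓝[>] 0) (𝓝[>] 0) := by
    refine tendsto_nhdsWithin_iff.2 ⟨?_, hpos.mono fun ε hε => pow_pos hε 3⟩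
    exact ((continuous_pow 3).tendsto' (0 : ℝ) 0 (by simp)).mono_left nhdsWithin_le_nhds
  have huc := (hμ₁.prod hμ₂).uniformContinuousOn_of_continuous (f := Function.uncurry q)
    hq.continuousOn
  obtain ⟨r, hr, hmod⟩ := Metric.uniformContinuousOn_iff.1 huc (η / 2) (half_pos hη)
  have hlt : ∀ᶠ ε in 𝓝[>] (0 : ℝ), ε ^ 3 < r :=
    (hcube.mono_right nhdsWithin_le_nhds).eventually_lt_const hr
  have hsmall : ∀ᶠ ε in 𝓝[>] (0 : ℝ), ε + ε ^ 2 + M * ε < η / 2 := by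
    have hcont : Continuous fun ε : ℝ => ε + ε ^ 2 + M * ε := by fun_prop
    exact ((hcont.tendsto' 0 0 (by simp)).mono_left nhdsWithin_le_nhds).eventually_lt_const
      (half_pos hη)
  filter_upwards [hpos, hcube.eventually hcov, hlt, hsmall] with ε hε hnet hεr hεη σ hσ
  obtain ⟨t, htK, htcard, htnet⟩ := hnet
  have hqmod : ∀ x ∈ (μ₁ : Measure X).support, ∀ y ∈ (μ₂ : Measure X).support,
      ∀ z ∈ (μ₂ : Measure X).support, edist z y ≤ ENNReal.ofReal (ε ^ 3) →
        (q x z : ℝ≥0∞) ≤ q x y + ENNReal.ofReal (η / 2) := by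
    intro x hx y hy z hz hzy
    have hdist : dist (x, z) (x, y) < r := by
      rw [edist_dist, ENNReal.ofReal_le_ofReal_iff (by positivity)] at hzy
      simpa [Prod.dist_eq, hr] using hzy.trans_lt hεr
    have h := hmod (x, z) (Set.mk_mem_prod hx hz) (x, y) (Set.mk_mem_prod hx hy) hdist
    simp only [Function.uncurry_apply_pair, NNReal.dist_eq] at h
    rw [← ENNReal.ofReal_coe_nnreal, ← ENNReal.ofReal_coe_nnreal,
      ← ENNReal.ofReal_add (q x y).coe_nonneg (half_pos hη).le]
    exact ENNReal.ofReal_le_ofReal (by linarith [(abs_lt.1 h).2])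
  obtain ⟨π', hπ'₁, hπ'⟩ := exists_penalizedCost_le_of_net
    (q := fun x y => (q x y : ℝ≥0∞)) (ENNReal.continuous_coe.comp hq).measurable d (ε := ε) htK htnet hqmod hσ
  refine ((hπ ε hε).2 π' hπ'₁).trans (hπ'.trans ?_)
  have hcard : ENNReal.ofReal (ε ^ (3 * d + 2)) * t.card ≤ ENNReal.ofReal (M * ε ^ 2) := by
    rw [← ENNReal.ofReal_natCast t.card, ← ENNReal.ofReal_mul (by positivity)]
    refine ENNReal.ofReal_le_ofReal ?_
    calc ε ^ (3 * d + 2) * t.card ≤ ε ^ (3 * d + 2) * (M * (ε ^ 3) ^ (-d)) := by gcongr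
      _ = M * (ε ^ (3 * d + 2) * ε ^ ((3 : ℝ) * -d)) := by
        rw [Real.rpow_mul hε.le]; norm_cast; ring
      _ = M * ε ^ 2 := by
        rw [← Real.rpow_add hε, ← Real.rpow_natCast]; congr 2; push_cast; ring
  have hM : 0 ≤ M * ε ^ 2 := by
    have h : 0 ≤ M * (ε ^ 3) ^ (-d) := (Nat.cast_nonneg _).trans htcard
    have : 0 ≤ M := nonneg_of_mul_nonneg_left h (by positivity)
    positivity
  have h1 : ENNReal.ofReal (1 / ε) * ENNReal.ofReal (ε ^ 3) = ENNReal.ofReal (ε ^ 2) := by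
    rw [← ENNReal.ofReal_mul (by positivity)]; congr 1; field_simp
  have hsum : ENNReal.ofReal (ε ^ 2) + ENNReal.ofReal (ε ^ 3) + ENNReal.ofReal ε *
      ENNReal.ofReal (η / 2) + ENNReal.ofReal (M * ε ^ 2) ≤ ENNReal.ofReal (ε * η) := by
    rw [← ENNReal.ofReal_mul hε.le, ← ENNReal.ofReal_add (by positivity) (by positivity),
      ← ENNReal.ofReal_add (by positivity) (by positivity),
      ← ENNReal.ofReal_add (by positivity) hM]
    refine ENNReal.ofReal_le_ofReal ?_
    have := mul_le_mul_of_nonneg_left hεη.le hε.le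
    linarith [this]
  calc _ ≤ ENNReal.ofReal (ε ^ 2) + (totalCost edist σ + ENNReal.ofReal (ε ^ 3)
        + ENNReal.ofReal ε * (totalCost (fun x y => (q x y : ℝ≥0∞)) σ + ENNReal.ofReal (η / 2)))
        + ENNReal.ofReal (M * ε ^ 2) := by rw [h1]; gcongr
    _ = totalCost edist σ + ENNReal.ofReal ε * totalCost (fun x y => (q x y : ℝ≥0∞)) σ
        + (ENNReal.ofReal (ε ^ 2) + ENNReal.ofReal (ε ^ 3) + ENNReal.ofReal ε *
          ENNReal.ofReal (η / 2) + ENNReal.ofReal (M * ε ^ 2)) := by ring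
    _ ≤ _ := by gcongr

/-- Convergence of the minimizers of `penalizedCost`, for a target measure whose support has
`δ`-nets of `O(δ ^ (-d))` points. -/
theorem tendsto_and_mapClusterPt_of_minimizers [StandardBorelSpace X] {q : X → X → ℝ≥0}
    (hq : Continuous (Function.uncurry q))
    (hμ₁ : IsCompact (μ₁ : Measure X).support) (hμ₂ : IsCompact (μ₂ : Measure X).support)
    {d M : ℝ} (hcov : ∀ᶠ δ in 𝓝[>] (0 : ℝ), ∃ t : Finset X, (t : Set X) ⊆ (μ₂ : Measure X).support ∧
      (t.card : ℝ) ≤ M * δ ^ (-d) ∧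
      ∀ y ∈ (μ₂ : Measure X).support, ∃ z ∈ t, edist z y ≤ ENNReal.ofReal δ)
    {π : ℝ → ProbabilityMeasure (X × X)}
    (hπ : ∀ ε : ℝ, 0 < ε →
      π ε ∈ minimizers (penalizedCost (fun x y => (q x y : ℝ≥0∞)) μ₂ d ε) {π | marginalOne π = μ₁}) :
    Tendsto (fun ε : ℝ => marginalTwo (π ε)) (𝓝[>] 0) (𝓝 μ₂) ∧
      ∀ π' : ProbabilityMeasure (X × X), MapClusterPt π' (𝓝[>] (0 : ℝ)) π →
        π' ∈ minimizers (totalCost fun x y => (q x y : ℝ≥0∞))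
          (minimizers (totalCost edist) (plans μ₁ μ₂)) := by
  set Q : X → X → ℝ≥0∞ := fun x y => (q x y : ℝ≥0∞)
  have hQc : Continuous (Function.uncurry Q) := ENNReal.continuous_coe.comp hq
  have hEc : Continuous (Function.uncurry (edist : X → X → ℝ≥0∞)) := continuous_edist
  have hpos : ∀ᶠ ε in 𝓝[>] (0 : ℝ), 0 < ε := eventually_mem_nhdsWithin
  have hle (η : ℝ) (hη : 0 < η) := eventually_penalizedCost_le hq hμ₁ hμ₂ hcov hπ hη
  have hEfin {σ} (hσ : σ ∈ plans μ₁ μ₂) : totalCost edist σ ≠ ∞ :=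
    (totalCost_lt_top hμ₁ hμ₂ hEc edist_ne_top hσ).ne
  have hQfin {σ} (hσ : σ ∈ plans μ₁ μ₂) : totalCost Q σ ≠ ∞ :=
    (totalCost_lt_top hμ₁ hμ₂ hQc (fun _ _ => ENNReal.coe_ne_top) hσ).ne
  have hofReal : Tendsto (fun ε : ℝ => ENNReal.ofReal ε) (𝓝[>] 0) (𝓝 0) :=
    (ENNReal.continuous_ofReal.tendsto' 0 0 (by simp)).mono_left nhdsWithin_le_nhds
  have hlim {σ} (hσ : σ ∈ plans μ₁ μ₂) : Tendsto (fun ε : ℝ => totalCost edist σ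
      + ENNReal.ofReal ε * totalCost Q σ + ENNReal.ofReal (ε * 1)) (𝓝[>] 0)
      (𝓝 (totalCost edist σ)) := by
    have h1 := ENNReal.Tendsto.mul_const hofReal (Or.inr (hQfin hσ))
    simpa using (h1.const_add (totalCost edist σ)).add hofReal
  have hprod : ∃ σ, σ ∈ plans μ₁ μ₂ :=
    ⟨μ₁.prod μ₂, by rw [mem_plans_iff]; constructor <;> simp⟩
  have hconv : Tendsto (fun ε : ℝ => marginalTwo (π ε)) (𝓝[>] 0) (𝓝 μ₂) := by
    obtain ⟨σ, hσ⟩ := hprod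
    refine tendsto_of_tendsto_transportCost ?_
    have h0 := ENNReal.Tendsto.mul hofReal (Or.inr (hEfin hσ)) (hlim hσ)
      (Or.inr ENNReal.zero_ne_top)
    rw [zero_mul] at h0
    refine tendsto_of_tendsto_of_tendsto_of_le_of_le' tendsto_const_nhds h0
      (Eventually.of_forall fun _ => bot_le) ?_
    filter_upwards [hpos, hle 1 one_pos] with ε hε h
    have hone : ENNReal.ofReal ε * ENNReal.ofReal (1 / ε) = 1 := by
      rw [← ENNReal.ofReal_mul hε.le, mul_one_div_cancel hε.ne', ENNReal.ofReal_one]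
    calc transportCost edist (marginalTwo (π ε)) μ₂
        = ENNReal.ofReal ε *
          (ENNReal.ofReal (1 / ε) * transportCost edist (marginalTwo (π ε)) μ₂) := by
          rw [← mul_assoc, hone, one_mul]
      _ ≤ _ := by
        gcongr
        refine le_trans ?_ (h σ hσ)
        rw [penalizedCost, add_assoc]
        exact le_self_add
  refine ⟨hconv, fun π' hπ' => ?_⟩
  have hplan : π' ∈ plans μ₁ μ₂ := by
    constructor
    · have hc : Tendsto (fun ε => marginalOne (π ε)) (𝓝[>] (0 : ℝ)) (𝓝 μ₁) :=
        tendsto_const_nhds.congr' (hpos.mono fun ε hε => ((hπ ε hε).1).symm)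
      exact eq_of_mapClusterPt_of_tendsto hπ'
        (ProbabilityMeasure.continuous_map continuous_fst).continuousAt hc
    · exact eq_of_mapClusterPt_of_tendsto hπ'
        (ProbabilityMeasure.continuous_map continuous_snd).continuousAt hconv
  have hopt : π' ∈ minimizers (totalCost edist) (plans μ₁ μ₂) := by
    refine ⟨hplan, fun σ hσ => ?_⟩
    refine le_of_mapClusterPt_of_lowerSemicontinuous (lowerSemicontinuous_totalCost hEc) hπ'
      (hlim hσ) ?_
    filter_upwards [hle 1 one_pos] with ε h
    refine le_trans ?_ (h σ hσ)
    rw [penalizedCost]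
    exact le_self_add.trans (le_add_self.trans le_self_add)
  refine ⟨hopt, fun σ hσ => ENNReal.le_of_forall_pos_le_add fun η hη _ => ?_⟩
  refine le_of_mapClusterPt_of_lowerSemicontinuous (lowerSemicontinuous_totalCost hQc) hπ'
    tendsto_const_nhds ?_
  have hlt1 : ∀ᶠ ε in 𝓝[>] (0 : ℝ), ε < 1 :=
    (tendsto_id.mono_left nhdsWithin_le_nhds).eventually_lt_const one_pos
  filter_upwards [hpos, hlt1, hle η hη] with ε hε hε1 h
  have hW : transportCost edist μ₁ μ₂ = totalCost edist σ :=
    le_antisymm (transportCost_le hσ.1) (le_iInf₂ hσ.2)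
  have hε' : ENNReal.ofReal ε ≠ 0 := by simpa using hε
  have hone : 1 ≤ ENNReal.ofReal (1 / ε) := by
    rw [ENNReal.one_le_ofReal, le_div_iff₀ hε]; linarith
  -- As `ε ≤ 1`, the penalty dominates what the triangle inequality loses.
  have hlow : totalCost edist σ + ENNReal.ofReal ε * totalCost Q (π ε) ≤
      totalCost edist σ + ENNReal.ofReal ε * (totalCost Q σ + η) := by
    calc totalCost edist σ + ENNReal.ofReal ε * totalCost Q (π ε)
        ≤ (totalCost edist (π ε) + transportCost edist (marginalTwo (π ε)) μ₂)
          + ENNReal.ofReal ε * totalCost Q (π ε) := by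
          rw [← hW]
          gcongr
          refine (transportCost_edist_triangle μ₁ (marginalTwo (π ε)) μ₂).trans ?_
          gcongr
          exact transportCost_le ⟨(hπ ε hε).1, rfl⟩
      _ ≤ (totalCost edist (π ε)
          + ENNReal.ofReal (1 / ε) * transportCost edist (marginalTwo (π ε)) μ₂)
          + ENNReal.ofReal ε * totalCost Q (π ε) := by
          gcongr
          exact le_mul_of_one_le_left' hone
      _ ≤ penalizedCost Q μ₂ d ε (π ε) := by
          rw [penalizedCost]
          refine le_trans (le_of_eq ?_) le_self_add
          ring
      _ ≤ _ := h σ hσ.1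
      _ = _ := by
          rw [ENNReal.ofReal_mul hε.le, ENNReal.ofReal_coe_nnreal]
          ring
  rw [ENNReal.add_le_add_iff_left (hEfin hσ.1), ENNReal.mul_le_mul_iff_right hε'
    ENNReal.ofReal_ne_top] at hlow
  exact hlow

end Convergence


/-! ### Nets in doubling sets -/

section Doubling

variable {X : Type*} [MeasurableSpace X] [MetricSpace X]

open scoped NNReal

theorem measure_ball_two_pow_le {ν : Measure X} {C R : ℝ} {x : X}
    (hdoub : ∀ r : ℝ, 0 < r → r ≤ R →
      ν (Metric.ball x (2 * r)) ≤ ENNReal.ofReal C * ν (Metric.ball x r))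
    {r : ℝ} (hr : 0 < r) (k : ℕ) (hk : 2 ^ k * r ≤ 2 * R) :
    ν (Metric.ball x (2 ^ k * r)) ≤ ENNReal.ofReal C ^ k * ν (Metric.ball x r) := by
  induction k with
  | zero => simp
  | succ k ih =>
    have hk' : 2 ^ k * r ≤ R := by rw [pow_succ] at hk; linarith
    have hpos : 0 < 2 ^ k * r := by positivity
    calc ν (Metric.ball x (2 ^ (k + 1) * r)) = ν (Metric.ball x (2 * (2 ^ k * r))) := by
          congr 2; ring
      _ ≤ ENNReal.ofReal C * (ENNReal.ofReal C ^ k * ν (Metric.ball x r)) :=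
          (hdoub _ hpos hk').trans (by gcongr; exact ih (by linarith))
      _ = _ := by rw [← mul_assoc, pow_succ']

variable [OpensMeasurableSpace X]

omit [OpensMeasurableSpace X] in
/-- Balls of a fixed radius around the points of a compact set have measure bounded below. -/
theorem exists_pos_le_measure_ball (ν : Measure X) [ν.IsOpenPosMeasure] {K : Set X}
    (hK : IsCompact K) {R : ℝ} (hR : 0 < R) :
    ∃ m : ℝ, 0 < m ∧ ∀ x ∈ K, ENNReal.ofReal m ≤ ν (Metric.ball x R) := by
  obtain ⟨s, -, hs, hcov⟩ := hK.finite_cover_balls (half_pos hR)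
  set m : ℝ≥0∞ := min (hs.toFinset.inf fun y => ν (Metric.ball y (R / 2))) 1
  have hm0 : 0 < m := by
    refine lt_min ?_ one_pos
    rw [Finset.lt_inf_iff ENNReal.zero_lt_top]
    exact fun y _ => Metric.measure_ball_pos ν y (half_pos hR)
  have hmt : m ≠ ∞ := ((min_le_right _ _).trans_lt ENNReal.one_lt_top).ne
  refine ⟨m.toReal, ENNReal.toReal_pos hm0.ne' hmt, fun x hx => ?_⟩
  rw [ENNReal.ofReal_toReal hmt]
  obtain ⟨y, hy, hxy⟩ := Set.mem_iUnion₂.1 (hcov hx)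
  refine ((min_le_left _ _).trans (Finset.inf_le (hs.mem_toFinset.2 hy))).trans (measure_mono ?_)
  refine Metric.ball_subset_ball' ?_
  rw [dist_comm]
  linarith [Metric.mem_ball.1 hxy]

/-- A `δ`-separated subset of a compact doubling set has at most `O(δ ^ (-log₂ C))` points: the balls
of radius `δ / 2` around its points are disjoint, and doubling them about `log₂ (2 R / δ)` times
produces balls whose measure is bounded below. -/
theorem exists_card_le_of_isSeparated (ν : Measure X) [IsFiniteMeasure ν] [ν.IsOpenPosMeasure]
    {K : Set X} (hK : IsCompact K) {C R : ℝ} (hC : 1 ≤ C) (hR : 0 < R)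
    (hdoub : ∀ x ∈ K, ∀ r : ℝ, 0 < r → r ≤ R →
      ν (Metric.ball x (2 * r)) ≤ ENNReal.ofReal C * ν (Metric.ball x r)) :
    ∃ M : ℝ, ∀ δ : ℝ, 0 < δ → δ < R → ∀ t : Finset X, (t : Set X) ⊆ K →
      Metric.IsSeparated (ENNReal.ofReal δ) (t : Set X) →
      (t.card : ℝ) ≤ M * δ ^ (-Real.logb 2 C) := by
  obtain ⟨m, hm, hmK⟩ := exists_pos_le_measure_ball ν hK hR
  have hC0 : 0 < C := one_pos.trans_le hC
  set d := Real.logb 2 C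
  have hd0 : 0 ≤ d := Real.logb_nonneg one_lt_two hC
  have h2d : (2 : ℝ) ^ d = C := Real.rpow_logb two_pos (by norm_num) hC0
  refine ⟨C * (2 * R) ^ d * ν.real Set.univ / m, fun δ hδ hδR t htK hsep => ?_⟩
  -- `k + 1` is the least number of doublings that take the radius `δ / 2` beyond `R`.
  obtain ⟨k, hk1, hk2⟩ := exists_nat_pow_near (x := 2 * R / δ) (y := (2 : ℝ))
    (by rw [one_le_div hδ]; linarith) one_lt_two
  rw [le_div_iff₀ hδ] at hk1
  rw [div_lt_iff₀ hδ] at hk2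
  have hball : ∀ x ∈ t, ENNReal.ofReal m ≤
      ENNReal.ofReal C ^ (k + 1) * ν (Metric.ball x (δ / 2)) := fun x hx => by
    refine (hmK x (htK hx)).trans ((measure_mono (Metric.ball_subset_ball ?_)).trans
      (measure_ball_two_pow_le (hdoub x (htK hx)) (half_pos hδ) (k + 1) ?_))
    · linarith
    · rw [pow_succ]; linarith
  have hdisj : (t : Set X).Pairwise fun x y =>
      AEDisjoint ν (Metric.ball x (δ / 2)) (Metric.ball y (δ / 2)) := fun x hx y hy hxy => by
    refine (Metric.ball_disjoint_ball ?_).aedisjoint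
    have h := hsep hx hy hxy
    simp only [edist_dist] at h
    linarith [((ENNReal.ofReal_lt_ofReal_iff_of_nonneg hδ.le).1 h)]
  have hsum : (t.card : ℝ≥0∞) * ENNReal.ofReal m ≤ ENNReal.ofReal C ^ (k + 1) * ν Set.univ := by
    calc (t.card : ℝ≥0∞) * ENNReal.ofReal m = ∑ _x ∈ t, ENNReal.ofReal m := by simp
      _ ≤ ∑ x ∈ t, ENNReal.ofReal C ^ (k + 1) * ν (Metric.ball x (δ / 2)) :=
          Finset.sum_le_sum hball
      _ = ENNReal.ofReal C ^ (k + 1) * ∑ x ∈ t, ν (Metric.ball x (δ / 2)) := by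
          rw [Finset.mul_sum]
      _ ≤ _ := by
          gcongr
          exact sum_measure_le_measure_univ
            (fun x _ => Metric.isOpen_ball.measurableSet.nullMeasurableSet) hdisj
  have hreal : (t.card : ℝ) * m ≤ C ^ (k + 1) * ν.real Set.univ := by
    have h := ENNReal.toReal_mono (by finiteness) hsum
    simpa [ENNReal.toReal_mul, hm.le, hC0.le, Measure.real] using h
  have hpow : C ^ (k + 1) ≤ C * ((2 * R) ^ d * δ ^ (-d)) := by
    rw [pow_succ']
    gcongr
    calc C ^ k = ((2 : ℝ) ^ k) ^ d := by
          rw [← h2d, ← Real.rpow_natCast, ← Real.rpow_natCast, ← Real.rpow_mul two_pos.le,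
            ← Real.rpow_mul two_pos.le, mul_comm]
      _ ≤ (2 * R / δ) ^ d := by
          gcongr
          rwa [le_div_iff₀ hδ]
      _ = (2 * R) ^ d * δ ^ (-d) := by
          rw [Real.div_rpow (by positivity) hδ.le, Real.rpow_neg hδ.le, div_eq_mul_inv]
  have h := hreal.trans (mul_le_mul_of_nonneg_right hpow measureReal_nonneg)
  rw [← le_div_iff₀ hm] at h
  refine h.trans (le_of_eq ?_)
  ring

theorem exists_net_of_doubling (ν : Measure X) [IsFiniteMeasure ν] [ν.IsOpenPosMeasure]
    {K : Set X} (hK : IsCompact K) {C R : ℝ} (hC : 1 ≤ C) (hR : 0 < R)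
    (hdoub : ∀ x ∈ K, ∀ r : ℝ, 0 < r → r ≤ R →
      ν (Metric.ball x (2 * r)) ≤ ENNReal.ofReal C * ν (Metric.ball x r)) :
    ∃ M : ℝ, ∀ᶠ δ in 𝓝[>] (0 : ℝ), ∃ t : Finset X, (t : Set X) ⊆ K ∧
      (t.card : ℝ) ≤ M * δ ^ (-Real.logb 2 C) ∧
      ∀ y ∈ K, ∃ z ∈ t, edist z y ≤ ENNReal.ofReal δ := by
  obtain ⟨M, hM⟩ := exists_card_le_of_isSeparated ν hK hC hR hdoub
  refine ⟨M, ?_⟩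
  filter_upwards [Ioo_mem_nhdsGT hR] with δ hδ
  set N : ℕ := ⌊M * δ ^ (-Real.logb 2 C)⌋₊
  have hpack : Metric.packingNumber δ.toNNReal K ≤ N := by
    refine iSup_le fun s => iSup_le fun hsK => iSup_le fun hs => ?_
    by_contra! hlt
    obtain ⟨t, hts, htN⟩ := Set.exists_subset_encard_eq (Order.add_one_le_of_lt hlt)
    have htfin : t.Finite := Set.finite_of_encard_eq_coe (k := N + 1) (by exact_mod_cast htN)
    have h := hM δ hδ.1 hδ.2 htfin.toFinset (by simpa using hts.trans hsK)
      (by rw [htfin.coe_toFinset]; exact hs.subset hts)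
    have hle := Nat.le_floor h
    rw [htfin.encard_eq_coe_toFinset_card] at htN
    norm_cast at htN
    omega
  have hfin : Metric.packingNumber δ.toNNReal K ≠ ⊤ := (hpack.trans_lt (ENat.natCast_lt_top N)).ne
  have htfin : (Metric.maximalSeparatedSet δ.toNNReal K).Finite := by
    rw [← Set.encard_ne_top_iff, Metric.encard_maximalSeparatedSet hfin]
    exact hfin
  refine ⟨htfin.toFinset, by simpa using Metric.maximalSeparatedSet_subset,
    hM δ hδ.1 hδ.2 _ (by simpa using Metric.maximalSeparatedSet_subset) ?_, fun y hy => ?_⟩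
  · rw [htfin.coe_toFinset]
    exact Metric.isSeparated_maximalSeparatedSet
  · obtain ⟨z, hz, hyz⟩ := Metric.isCover_maximalSeparatedSet hfin hy
    exact ⟨z, htfin.mem_toFinset.2 hz, by rw [edist_comm]; exact hyz⟩

end Doubling

/-! ### Convex sets in Euclidean space -/

section Euclidean

variable {n : ℕ} {Ω : Set (EuclideanSpace ℝ (Fin n))}

/-- A convex set with non-empty interior lies in the closure of its interior, so its non-empty
relatively open subsets have positive Lebesgue measure. -/
theorem isOpenPosMeasure_comap_volume_of_convex (hΩ_convex : Convex ℝ Ω)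
    (hΩ_meas : MeasurableSet Ω) (hΩ_interior : (interior Ω).Nonempty) :
    (Measure.comap Subtype.val volume : Measure Ω).IsOpenPosMeasure := by
  refine ⟨fun U hU ⟨x, hx⟩ => ?_⟩
  obtain ⟨V, hV, rfl⟩ := isOpen_induced_iff.1 hU
  have hxcl : (x : EuclideanSpace ℝ (Fin n)) ∈ closure (interior Ω) := by
    rw [hΩ_convex.closure_interior_eq_closure_of_nonempty_interior hΩ_interior]
    exact subset_closure x.2
  have hne : (V ∩ interior Ω).Nonempty := mem_closure_iff.1 hxcl V hV hx
  rw [comap_subtype_coe_apply hΩ_meas, Subtype.image_preimage_coe]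
  refine ((hV.inter isOpen_interior).measure_pos volume hne).trans_le (measure_mono ?_) |>.ne'
  exact fun y hy => ⟨interior_subset hy.2, hy.1⟩

theorem rhoCost_eq_edist (ρ : MetricSpace Ω) : rhoCost ρ = ρ.toPseudoMetricSpace.edist :=
  funext fun x => funext fun y => (ρ.toPseudoMetricSpace.edist_dist x y).symm

theorem continuous_nnnorm_sub_sq :
    Continuous (Function.uncurry fun x y : Ω =>
      ‖(x : EuclideanSpace ℝ (Fin n)) - y‖₊ ^ 2) := by
  unfold Function.uncurry
  fun_prop

theorem sqCost_eq_coe :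
    (sqCost : Ω → Ω → ℝ≥0∞) =
      fun x y : Ω => ((‖(x : EuclideanSpace ℝ (Fin n)) - y‖₊ ^ 2 : NNReal) : ℝ≥0∞) := by
  funext x y
  rw [sqCost, ← ENNReal.ofReal_coe_nnreal]
  simp

theorem totalCost_perturbedCost (ρ : MetricSpace Ω) {ε : ℝ} (hε : 0 < ε)
    (π : ProbabilityMeasure (Ω × Ω)) :
    totalCost (perturbedCost ρ ε) π =
      totalCost (rhoCost ρ) π + ENNReal.ofReal ε * totalCost sqCost π := by
  have hm : Measurable fun p : Ω × Ω => ENNReal.ofReal ε * sqCost p.1 p.2 := by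
    rw [sqCost_eq_coe]
    exact (ENNReal.continuous_coe.comp continuous_nnnorm_sub_sq).measurable.const_mul _
  rw [totalCost, totalCost, totalCost, ← lintegral_const_mul' _ _ ENNReal.ofReal_ne_top,
    ← lintegral_add_right _ hm]
  refine lintegral_congr fun p => ?_
  rw [perturbedCost, rhoCost, sqCost, ENNReal.ofReal_add (@dist_nonneg _ ρ.toPseudoMetricSpace _ _)
    (by positivity), ENNReal.ofReal_mul hε.le]

/-- The metric is replaced by one whose topology is definitionally the subspace topology, so that both
sides refer to the same notion of support. -/
theorem penalized_eq_penalizedCost (ρ : MetricSpace Ω)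
    (h : instTopologicalSpaceSubtype = ρ.toPseudoMetricSpace.toUniformSpace.toTopologicalSpace)
    (μ₂ : ProbabilityMeasure Ω) (d : ℝ) {ε : ℝ} (hε : 0 < ε) (π : ProbabilityMeasure (Ω × Ω)) :
    penalized ρ μ₂ d ε π = @penalizedCost Ω _
      (ρ.replaceTopology h).toPseudoMetricSpace.toPseudoEMetricSpace sqCost μ₂ d ε π := by
  unfold penalizedCost
  rw [penalized, totalCost_perturbedCost ρ hε]
  unfold wassersteinOne
  rw [rhoCost_eq_edist]
  rfl

theorem rhoBall_eq_image_ball (ρ : MetricSpace Ω) (x : Ω) (r : ℝ) :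
    rhoBall ρ x r = Subtype.val '' (@Metric.ball Ω ρ.toPseudoMetricSpace x r) := by
  refine congrArg (Set.image Subtype.val) (Set.ext fun z => ?_)
  exact (@Metric.mem_ball' Ω ρ.toPseudoMetricSpace x z r).symm

end Euclidean

end MongeProjective


theorem mainTheorem6 {n : ℕ} (Ω : Set (EuclideanSpace ℝ (Fin n)))
    (hΩ_bounded : Bornology.IsBounded Ω) (hΩ_convex : Convex ℝ Ω) (hΩ_Gδ : IsGδ Ω)
    (hΩ_interior : (interior Ω).Nonempty)
    (ρ : MetricSpace Ω) (hρ : MongeProjective.AssumptionA ρ)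
    (μ₁ μ₂ : ProbabilityMeasure Ω)
    (hμ₁ : IsCompact (μ₁ : Measure Ω).support) (hμ₂ : IsCompact (μ₂ : Measure Ω).support)
    (C : ℝ) (hC : MongeProjective.IsDoublingConstant ρ (μ₂ : Measure Ω).support C)
    (π : ℝ → ProbabilityMeasure (Ω × Ω))
    (hπ : ∀ ε : ℝ, 0 < ε →
      π ε ∈ MongeProjective.penalizedMinimizers ρ μ₁ μ₂ (Real.logb 2 C) ε) :
    Tendsto (fun ε : ℝ => MongeProjective.marginalTwo (π ε)) (𝓝[>] 0) (𝓝 μ₂) ∧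
      ∀ π' : ProbabilityMeasure (Ω × Ω), MapClusterPt π' (𝓝[>] (0 : ℝ)) π →
        π' ∈ MongeProjective.secondaryOptimalPlans ρ μ₁ μ₂ := by
  have hΩ_meas : MeasurableSet Ω := hΩ_Gδ.measurableSet
  have : StandardBorelSpace Ω := hΩ_meas.standardBorel
  have := MongeProjective.isOpenPosMeasure_comap_volume_of_convex hΩ_convex hΩ_meas hΩ_interior
  have : IsFiniteMeasure (Measure.comap Subtype.val volume : Measure Ω) := ⟨by
    rw [comap_subtype_coe_apply hΩ_meas, Set.image_univ, Subtype.range_val]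
    exact hΩ_bounded.measure_lt_top⟩
  obtain ⟨hC1, R, hR, hdoub⟩ := hC
  -- `ρ` with its topology made definitionally equal to the subspace topology.
  let ρ' : MetricSpace Ω := ρ.replaceTopology hρ.topology_eq.symm
  have hvol (x : Ω) (r : ℝ) : volume (MongeProjective.rhoBall ρ x r) =
      (Measure.comap Subtype.val volume : Measure Ω) (@Metric.ball Ω ρ'.toPseudoMetricSpace x r) := by
    rw [MongeProjective.rhoBall_eq_image_ball, comap_subtype_coe_apply hΩ_meas]
    rfl
  obtain ⟨M, hcov⟩ := @MongeProjective.exists_net_of_doubling Ω _ ρ' _ (Measure.comap Subtype.val volume) _ _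
    (μ₂ : Measure Ω).support hμ₂ C R hC1 hR fun x hx r hr hrR => by
      rw [← hvol, ← hvol]
      exact hdoub x hx r hr hrR
  have key := @MongeProjective.tendsto_and_mapClusterPt_of_minimizers Ω _ ρ' _ _ μ₁ μ₂ _ _
    MongeProjective.continuous_nnnorm_sub_sq hμ₁ hμ₂ (Real.logb 2 C) M hcov π fun ε hε => by
      refine ⟨(hπ ε hε).1, fun b hb => ?_⟩
      have h := (hπ ε hε).2 b hb
      rw [MongeProjective.penalized_eq_penalizedCost ρ hρ.topology_eq.symm _ _ hε,
        MongeProjective.penalized_eq_penalizedCost ρ hρ.topology_eq.symm _ _ hε,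
        MongeProjective.sqCost_eq_coe] at h
      exact h
  refine ⟨key.1, fun π' hπ' => ?_⟩
  rw [MongeProjective.secondaryOptimalPlans, MongeProjective.optimalPlans,
    MongeProjective.rhoCost_eq_edist, MongeProjective.sqCost_eq_coe]
  exact key.2 π' hπ'
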